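/- There is a constant $C$ such that for every $k\in\mathbb{N}$ there is a temperature-1 system of the Signal Tile Assembly Model (STAM), whose initial assemblies are exactly 4 single-tile supertiles (4 tile types) carrying at most $C\,k$ glues each, all of strength 1, which uniquely assembles the $2^k\times 1$ line. Here an active tile is a unit square carrying on each side a set of glues of distinct types, each in one of the states latent, on, off, a set of labels with such states, a transition function that assigns to a side and a glue type a finite set of actions (turn a given glue or label of this tile on or off), and a multiset of pending actions; a supertile is a placement of such tiles on a finite nonempty set of positions of $\mathbb{Z}^2$. Two equal glues on abutting sides of neighbouring tiles are bound when both are on; whenever such a bond is formed, by the combination of two supertiles or by a glue being turned on, both tiles add the actions that their transition functions assign to this glue to their pending multisets. A system consists of finitely many initial supertiles, with no pending actions and all glues latent or on, and a temperature $\tau\ge 1$. A supertile is $\tau$-stable if every partition of its tiles into two nonempty parts cuts bonds of total strength at least $\tau$. The producible supertiles are obtained from the initial ones by repeatedly (i) combining two $\tau$-stable producible supertiles that can be translated, without overlap, so that the bonds along their common boundary have total strength at least $\tau$; (ii) breaking a supertile along a cut of strength less than $\tau$; (iii) executing, and thereby removing, one pending action (valid state changes are latent to on, latent to off and on to off; any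 other leaves the state unchanged). A producible supertile is terminal if no combination with a producible supertile, no break and no pending transition is possible. The system uniquely assembles a shape $X\subset\mathbb{Z}^2$ if a terminal supertile exists, the tiles of every terminal supertile occupy exactly the positions of a translate of $X$, and every producible supertile can evolve by such steps into a terminal one. -/

import Mathlib

namespace STAM

/-- The four sides of a unit square tile. -/
inductive Side
  | north | south | east | west
  deriving DecidableEq

instance : Fintype Side where
  elems := {.north, .south, .east, .west}
  complete := fun d => by cases d <;> simp

/-- The side of the neighbouring tile that abuts the given side. -/
def Side.opp : Side → Side
  | .north => .south
  | .south => .north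
  | .east => .west
  | .west => .east

/-- The displacement to the neighbouring position across the given side. -/
def Side.vec : Side → ℤ × ℤ
  | .north => (0, 1)
  | .south => (0, -1)
  | .east => (1, 0)
  | .west => (-1, 0)

/-- The states of a glue or of a label. -/
inductive GState
  | latent | on | off
  deriving DecidableEq

/-- The target of an action: turn on, or turn off. -/
inductive Switch
  | on | off
  deriving DecidableEq

/-- The state after an action has been executed. The valid changes are `latent → on`,
`latent → off` and `on → off`; any other action leaves the state as it is. -/
def GState.next : GState → Switch → GState
  | .latent, .on => .on
  | .latent, .off => .off
  | .on, .on => .on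
  | .on, .off => .off
  | .off, _ => .off

/-- Glue actions `(d, g, s)` and label actions `(x, s)` over glue types `Γ` and labels `Λ`. -/
inductive Action (Γ Λ : Type)
  | glue (d : Side) (g : Γ) (s : Switch)
  | label (x : Λ) (s : Switch)

/-- An active tile `(G, L, δ, Π)`. `glue d g` is the state of the glue of type `g` on side `d`,
or `none` if there is none (so a side carries at most one glue of each type); `label x` is the
state of the label `x`, or `none` if the tile does not have it; `δ d g` is the set of actions
requested when the glue `g` on side `d` binds; `pending` is the multiset of actions that have
been requested and not yet been executed. -/
structure ActiveTile (Γ Λ : Type) where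
  glue : Side → Γ → Option GState
  label : Λ → Option GState
  δ : Side → Γ → Finset (Action Γ Λ)
  pending : Multiset (Action Γ Λ)

/-- The number of glues on the four sides of a tile, whatever their state. -/
def ActiveTile.glueCount {Γ Λ : Type} [Fintype Γ] (t : ActiveTile Γ Λ) : ℕ :=
  ∑ d : Side, (Finset.univ.filter (fun g : Γ => (t.glue d g).isSome = true)).card

/-- A partial placement of active tiles on the integer lattice. -/
abbrev Placement (Γ Λ : Type) : Type := ℤ × ℤ → Option (ActiveTile Γ Λ)

/-- An active supertile: a placement of active tiles on a finite nonempty set of positions. -/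
structure Supertile (Γ Λ : Type) where
  tile : Placement Γ Λ
  dom : Finset (ℤ × ℤ)
  mem_dom : ∀ p, p ∈ dom ↔ (tile p).isSome = true
  nonempty : dom.Nonempty

/-- The supertile that consists of a single tile, at the origin. -/
def Supertile.single {Γ Λ : Type} (t : ActiveTile Γ Λ) : Supertile Γ Λ where
  tile := fun p => if p = (0, 0) then some t else none
  dom := {(0, 0)}
  mem_dom := fun p => by by_cases h : p = (0, 0) <;> simp [h]
  nonempty := ⟨(0, 0), by simp⟩

section Bonds

variable {Γ Λ : Type} [Fintype Γ] [DecidableEq Γ]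

/-- The glues in state `on` on side `d` of the tile at position `p`. -/
def onGlues (c : Placement Γ Λ) (p : ℤ × ℤ) (d : Side) : Finset Γ :=
  match c p with
  | some t => Finset.univ.filter (fun g => t.glue d g = some GState.on)
  | none => ∅

/-- The glues that are bound across side `d` of position `p`: those that are `on` on both of
the abutting tile sides. -/
def bonds (c : Placement Γ Λ) (p : ℤ × ℤ) (d : Side) : Finset Γ :=
  onGlues c p d ∩ onGlues c (p + d.vec) d.opp

/-- The total strength of the bonds between the positions `X` and the positions `Y`
(for disjoint `X` and `Y`; every bond is counted once, from its end in `X`). -/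
def cutStrength (strength : Γ → ℤ) (c : Placement Γ Λ) (X Y : Finset (ℤ × ℤ)) : ℤ :=
  ∑ p ∈ X, ∑ d : Side, if p + d.vec ∈ Y then ∑ g ∈ bonds c p d, strength g else 0

/-- `X` and `Y` form a cut of `D`: a partition of `D` into two nonempty parts. -/
def IsCut (D X Y : Finset (ℤ × ℤ)) : Prop :=
  X.Nonempty ∧ Y.Nonempty ∧ Disjoint X Y ∧ X ∪ Y = D

/-- `τ`-stability: every cut has strength at least `τ`. -/
def Stable (strength : Γ → ℤ) (τ : ℕ) (A : Supertile Γ Λ) : Prop :=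
  ∀ X Y, IsCut A.dom X Y → (τ : ℤ) ≤ cutStrength strength A.tile X Y

/-- The tile at `p` fires its transition function for every side `d` and every glue in `N p d`:
the actions that the transition function outputs are added to the pending multiset. -/
def fire (c : Placement Γ Λ) (N : ℤ × ℤ → Side → Finset Γ) : Placement Γ Λ := fun p =>
  (c p).map fun t =>
    { t with pending := t.pending + ∑ d : Side, ∑ g ∈ N p d, (t.δ d g).val }

/-- The placement moved by the vector `v`. -/
def shift (v : ℤ × ℤ) (c : Placement Γ Λ) : Placement Γ Λ := fun p => c (p - v)

/-- The union of two placements (used for disjoint ones only). -/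
def union (c c' : Placement Γ Λ) : Placement Γ Λ := fun p => (c p).or (c' p)

/-- The restriction of a placement to a set of positions. -/
def restrict (c : Placement Γ Λ) (X : Finset (ℤ × ℤ)) : Placement Γ Λ := fun p =>
  if p ∈ X then c p else none

/-- `A` and `B` are `τ`-combinable into `C`: both are `τ`-stable, `B` can be translated (not
rotated) so that the two do not overlap and the glues that are `on` along their boundary bind
with total strength at least `τ`, and `C` is their union after the transition functions have
been fired by all the bonds that are new. -/
def Combines (strength : Γ → ℤ) (τ : ℕ) (A B C : Supertile Γ Λ) : Prop :=
  Stable strength τ A ∧ Stable strength τ B ∧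
  ∃ v : ℤ × ℤ,
    let Y := B.dom.image (fun p => p + v)
    let B' := shift v B.tile
    let U := union A.tile B'
    Disjoint A.dom Y ∧
    (τ : ℤ) ≤ cutStrength strength U A.dom Y ∧
    C.tile = fire U (fun p d => bonds U p d \ (bonds A.tile p d ∪ bonds B' p d))

/-- `A` is `τ`-breakable into `B` and `C`, along a cut of strength less than `τ`. -/
def Breaks (strength : Γ → ℤ) (τ : ℕ) (A B C : Supertile Γ Λ) : Prop :=
  ∃ X Y, IsCut A.dom X Y ∧ cutStrength strength A.tile X Y < (τ : ℤ) ∧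
    B.tile = restrict A.tile X ∧ C.tile = restrict A.tile Y

/-- One pending action on a glue of one tile of `A` is executed and removed from the pending
multiset. If the glue is thereby turned `on` and meets the same glue, in state `on`, on the
abutting side of a neighbour, the two bind and fire the transition functions of both tiles. -/
def GlueTransition (A B : Supertile Γ Λ) : Prop :=
  ∃ (p : ℤ × ℤ) (t : ActiveTile Γ Λ) (d : Side) (g : Γ) (s : Switch) (q : GState)
    (rest : Multiset (Action Γ Λ)),
    A.tile p = some t ∧ t.glue d g = some q ∧ t.pending = Action.glue d g s ::ₘ rest ∧
    let t' : ActiveTile Γ Λ :=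
      { t with
        glue := fun d' g' => if d' = d ∧ g' = g then some (q.next s) else t.glue d' g'
        pending := rest }
    let c : Placement Γ Λ := fun p' => if p' = p then some t' else A.tile p'
    B.tile = fire c (fun p' d' => bonds c p' d' \ bonds A.tile p' d')

/-- One pending action on a label of one tile of `A` is executed and removed from the pending
multiset. -/
def LabelTransition (A B : Supertile Γ Λ) : Prop :=
  ∃ (p : ℤ × ℤ) (t t' : ActiveTile Γ Λ) (x : Λ) (s : Switch) (q : GState)
    (rest : Multiset (Action Γ Λ)),
    A.tile p = some t ∧ t.label x = some q ∧ t.pending = Action.label x s ::ₘ rest ∧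
    t'.glue = t.glue ∧ t'.δ = t.δ ∧ t'.pending = rest ∧
    t'.label x = some (q.next s) ∧ (∀ y, y ≠ x → t'.label y = t.label y) ∧
    B.tile = fun p' => if p' = p then some t' else A.tile p'

end Bonds

/-- A signal tile assembly system: the strengths of the glue types, a finite set of initial
active supertiles, and a positive temperature. Initially no action is pending and every glue
is `latent` or `on`. -/
structure System (Γ Λ : Type) where
  strength : Γ → ℤ
  initial : Set (Supertile Γ Λ)
  temperature : ℕ
  initial_finite : initial.Finite
  temperature_pos : 0 < temperature
  initial_pending : ∀ A ∈ initial, ∀ p t, A.tile p = some t → t.pending = 0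
  initial_state : ∀ A ∈ initial, ∀ p t, A.tile p = some t →
    ∀ d g, t.glue d g ≠ some GState.off

namespace System

variable {Γ Λ : Type} [Fintype Γ] [DecidableEq Γ]

/-- The producible supertiles of a system. -/
inductive Producible (S : System Γ Λ) : Supertile Γ Λ → Prop
  | base {A : Supertile Γ Λ} : A ∈ S.initial → Producible S A
  | combine {A B C : Supertile Γ Λ} : Producible S A → Producible S B →
      Combines S.strength S.temperature A B C → Producible S C
  | break_left {A B C : Supertile Γ Λ} : Producible S A →
      Breaks S.strength S.temperature A B C → Producible S B
  | break_right {A B C : Supertile Γ Λ} : Producible S A →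
      Breaks S.strength S.temperature A B C → Producible S C
  | glue {A B : Supertile Γ Λ} : Producible S A → GlueTransition A B → Producible S B
  | label {A B : Supertile Γ Λ} : Producible S A → LabelTransition A B → Producible S B

/-- One step in the evolution of the supertile `A`: it combines with a producible supertile,
or breaks (and `B` is one of the two pieces), or undergoes a glue or label transition. -/
def Step (S : System Γ Λ) (A B : Supertile Γ Λ) : Prop :=
  (∃ C, S.Producible C ∧ Combines S.strength S.temperature A C B) ∨
  (∃ C, Breaks S.strength S.temperature A B C) ∨
  GlueTransition A B ∨ LabelTransition A B

/-- A terminal supertile: producible, and no combination, break, glue transition or label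
transition is possible. -/
def Terminal (S : System Γ Λ) (A : Supertile Γ Λ) : Prop :=
  S.Producible A ∧ ∀ B, ¬ S.Step A B

/-- The system uniquely assembles the shape `X`: there is a terminal supertile, every terminal
supertile has exactly the shape `X` up to translation, and every producible supertile can
evolve into a terminal one. -/
def UniquelyAssembles (S : System Γ Λ) (X : Set (ℤ × ℤ)) : Prop :=
  (∃ A, S.Terminal A) ∧
  (∀ A, S.Terminal A → ∃ v : ℤ × ℤ, (A.dom : Set (ℤ × ℤ)) = (fun p => p + v) '' X) ∧
  (∀ A, S.Producible A → ∃ B, Relation.ReflTransGen S.Step A B ∧ S.Terminal B)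

end System

/-- The `n × 1` line: `n` consecutive positions in a horizontal row. -/
def line (n : ℕ) : Set (ℤ × ℤ) := {p | 0 ≤ p.1 ∧ p.1 < (n : ℤ) ∧ p.2 = 0}

end STAM

/-! A line of length `2 ^ i` carries two bits `(s, x)`. The bit `s` is its role in the next
doubling: a left part, active on its east end only (`s = true`), or a right part, active on its west
end only (`s = false`). The bit `x` is a payload. When `(true, x)` meets `(false, y)`, the glue
`bond x y` of level `i` reveals both payloads at the junction, and the product is a line of level `i
+ 1` and kind `(x, y)`. So `(s, x)` arises from `(true, s)` and `(false, x)`: four kinds at one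
level give all four at the next, and the four tile types are the kinds of level 0.

The payload `x` decides which end of the product becomes active, and `y` has to be carried there:
west through the left half, or east through the right half. It passes each inner boundary by binding
a message glue of level `i + 1` to a port, opened when that boundary was first bound. The opposite
end stays blank. There are no glues of level `k`, so growth stops at length `2 ^ k`.

Actions are executed in any order, and lines may combine while messages are still travelling. The
invariant `LineState` therefore refers to the limit: `F` is the least set of glues that contains
those now on and is closed under the requests of bonds. `Spec.join` and `Spec.join_le` compute this
set for a joined line, `LineState.touch` shows that only matching ends bind, and
`isLine_of_producible` propagates the invariant. No glue is ever turned off, so nothing breaks;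
pending actions run out (`IsLine.exists_quiet`), after which a line below level `k` can always be
doubled. -/

namespace STAM
namespace Doubling

/-! ### Glues, requests and tile types -/

/-- The symbols carried by the glues: `bond x y` joins a left part with bit `x` to a right part
with bit `y`, `east x` and `west y` carry a message of one bit along the line. -/
inductive Sym
  | bond (x y : Bool)
  | east (x : Bool)
  | west (y : Bool)
  deriving DecidableEq, Fintype

/-- A glue is a level together with a symbol. -/
abbrev Glue (k : ℕ) : Type := Fin k × Sym

variable {k : ℕ}

/-- The glues shown on the east by a left part of level `j` with bit `x`. -/
def EastFace (j : ℕ) (x : Bool) (g : Glue k) : Prop :=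
  (g.1 : ℕ) = j ∧ (g.2 = .east x ∨ ∃ y, g.2 = .bond x y)

/-- The glues shown on the west by a right part of level `j` with bit `y`. -/
def WestFace (j : ℕ) (y : Bool) (g : Glue k) : Prop :=
  (g.1 : ℕ) = j ∧ (g.2 = .west y ∨ ∃ x, g.2 = .bond x y)

/-- The glues that let an east side bound at level `j` receive later messages. -/
def EastPort (j : ℕ) (g : Glue k) : Prop := j < (g.1 : ℕ) ∧ ∃ y, g.2 = .west y

/-- The glues that let a west side bound at level `j` receive later messages. -/
def WestPort (j : ℕ) (g : Glue k) : Prop := j < (g.1 : ℕ) ∧ ∃ x, g.2 = .east x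

/-- `Req d g d' g'`: binding `g` on side `d` requests that `g'` be turned on on side `d'`. -/
def Req (d : Side) (g : Glue k) (d' : Side) (g' : Glue k) : Prop :=
  match d, g.2 with
  | .east, .bond x y =>
      (d' = .east ∧ EastPort g.1 g') ∨ (x = false ∧ d' = .west ∧ WestFace (g.1 + 1) y g')
  | .west, .bond x y =>
      (d' = .west ∧ WestPort g.1 g') ∨ (x = true ∧ d' = .east ∧ EastFace (g.1 + 1) y g')
  | .east, .west y => d' = .west ∧ WestFace g.1 y g'
  | .west, .east x => d' = .east ∧ EastFace g.1 x g'
  | _, _ => False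

open Classical in
/-- The common transition function of the four tile types. -/
noncomputable def delta (k : ℕ) (d : Side) (g : Glue k) : Finset (Action (Glue k) (Bool × Bool)) :=
  (Finset.univ.filter fun q : Side × Glue k => Req d g q.1 q.2).map
    ⟨fun q => .glue q.1 q.2 .on, fun q r h => by
      simp only [Action.glue.injEq, and_true] at h; exact Prod.ext h.1 h.2⟩

theorem mem_delta {d : Side} {g : Glue k} {α : Action (Glue k) (Bool × Bool)} :
    α ∈ delta k d g ↔ ∃ d' g', Req d g d' g' ∧ α = .glue d' g' .on := by
  simp only [delta, Finset.mem_map, Finset.mem_filter, Finset.mem_univ, true_and]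
  constructor
  · rintro ⟨⟨d', g'⟩, h, rfl⟩; exact ⟨d', g', h, rfl⟩
  · rintro ⟨d', g', h, rfl⟩; exact ⟨(d', g'), h, rfl⟩

/-- The glues that are initially on, for the tile type of kind `κ`. -/
def Init (κ : Bool × Bool) (d : Side) (g : Glue k) : Prop :=
  (κ.1 = true ∧ d = .east ∧ EastFace 0 κ.2 g) ∨ (κ.1 = false ∧ d = .west ∧ WestFace 0 κ.2 g)

open Classical in
/-- The four tile types. -/
noncomputable def tile (k : ℕ) (κ : Bool × Bool) : ActiveTile (Glue k) (Bool × Bool) where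
  glue d g :=
    if d = .east ∨ d = .west then some (if Init κ d g then .on else .latent) else none
  label y := if y = κ then some .on else none
  δ := delta k
  pending := 0

/-! ### Eventual glues of a line, and their behaviour under joining -/

/-- `O` is closed under the requests of the bonds between consecutive positions of `[a, e]`. -/
def ClosedOn (O : ℤ → Side → Glue k → Prop) (a e : ℤ) : Prop :=
  ∀ n, a ≤ n → n < e → ∀ g, O n .east g → O (n + 1) .west g →
    ∀ d' g', (Req .east g d' g' → O n d' g') ∧ (Req .west g d' g' → O (n + 1) d' g')

/-- `F` describes the glues that are eventually on in a line of level `i` and kind `(s, x)` on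
the positions `[a, e]`. -/
structure Spec (F : ℤ → Side → Glue k → Prop) (i : ℕ) (s x : Bool) (a e : ℤ) : Prop where
  horizontal : ∀ n d g, F n d g → d = .east ∨ d = .west
  east_level : ∀ n, a ≤ n → n ≤ e → ∀ g, F n .east g → i < (g.1 : ℕ) → ∃ y, g.2 = .west y
  west_level : ∀ n, a ≤ n → n ≤ e → ∀ g, F n .west g → i < (g.1 : ℕ) → ∃ y, g.2 = .east y
  east_port : ∀ n, a ≤ n → n < e → ∀ g y, i ≤ (g.1 : ℕ) → g.2 = .west y → F n .east g
  west_port : ∀ n, a < n → n ≤ e → ∀ g y, i ≤ (g.1 : ℕ) → g.2 = .east y → F n .west g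
  east_end : ∀ g, F e .east g ↔ s = true ∧ EastFace i x g
  west_end : ∀ g, F a .west g ↔ s = false ∧ WestFace i x g
  closed : ClosedOn F a e

theorem Spec.leaf (κ : Bool × Bool) (a : ℤ) :
    Spec (k := k) (fun _ => Init κ) 0 κ.1 κ.2 a a where
  horizontal := by unfold Init; grind
  east_level := by unfold Init EastFace; grind
  west_level := by unfold Init WestFace; grind
  east_port := by grind
  west_port := by grind
  east_end := by unfold Init; grind
  west_end := by unfold Init; grind
  closed := by unfold ClosedOn; grind

/-- The glues that are eventually on after two lines of level `i`, with bits `x` and `y`, have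
been joined across the boundary between `m` and `m + 1`. -/
def join (F₁ F₂ : ℤ → Side → Glue k → Prop) (i : ℕ) (x y : Bool) (m : ℤ) (n : ℤ) (d : Side)
    (g : Glue k) : Prop :=
  (n ≤ m ∧ (F₁ n d g ∨ (n = m ∧ d = .east ∧ EastPort i g) ∨
    (x = false ∧ d = .west ∧ WestFace (i + 1) y g))) ∨
  (m < n ∧ (F₂ n d g ∨ (n = m + 1 ∧ d = .west ∧ WestPort i g) ∨
    (x = true ∧ d = .east ∧ EastFace (i + 1) y g)))

/-- The two faces at the junction have level `i` and share only `bond x y`. The ports opened there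
have level above `i`, and they expect messages of opposite directions on the two sides, so they
match neither the faces nor each other. -/
theorem join_closed_junction {F₁ F₂ : ℤ → Side → Glue k → Prop} {i : ℕ} {x y : Bool}
    {a m e : ℤ} (h₁ : Spec F₁ i true x a m) (h₂ : Spec F₂ i false y (m + 1) e) {g : Glue k}
    (he : join F₁ F₂ i x y m m .east g) (hw : join F₁ F₂ i x y m (m + 1) .west g) :
    (g.1 : ℕ) = i ∧ g.2 = .bond x y := by
  have e1 := h₁.east_end g
  have e2 := h₂.west_end g
  unfold join at he hw
  unfold EastFace EastPort at *
  unfold WestFace WestPort at *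
  grind

/-- Closure is the substantial field. At the junction the only bond is `bond x y`, whose requests
are built into `join`; at an inner boundary the only possible new bond is the travelling message,
whose request is the face already placed on every tile of that half. -/
theorem Spec.join {F₁ F₂ : ℤ → Side → Glue k → Prop} {i : ℕ} {x y : Bool} {a m e : ℤ}
    (h₁ : Spec F₁ i true x a m) (h₂ : Spec F₂ i false y (m + 1) e) (ham : a ≤ m) (hme : m < e) :
    Spec (join F₁ F₂ i x y m) (i + 1) x y a e where
  horizontal n d g h := by
    have := h₁.horizontal n d g
    have := h₂.horizontal n d g
    unfold Doubling.join at h; grind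
  east_level n han hne g h hi := by
    have := h₁.east_level n han
    have := h₂.east_level n
    unfold Doubling.join EastPort EastFace at h; grind
  west_level n han hne g h hi := by
    have := h₁.west_level n han
    have := h₂.west_level n
    unfold Doubling.join WestPort WestFace at h; grind
  east_port n han hne g z hi hg := by
    have := h₁.east_port n han
    have := h₂.east_port n
    unfold Doubling.join EastPort; grind
  west_port n han hne g z hi hg := by
    have := h₁.west_port n han
    have := h₂.west_port n
    unfold Doubling.join WestPort; grind
  east_end g := by
    have := h₂.east_end g
    unfold Doubling.join; grind
  west_end g := by
    have := h₁.west_end g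
    unfold Doubling.join; grind
  closed n han hne g he hw d' g' := by
    rcases lt_trichotomy n m with hnm | rfl | hnm
    · have hF : F₁ n .east g := by unfold Doubling.join at he; grind
      have hw' : F₁ (n + 1) .west g ∨ (x = false ∧ WestFace (i + 1) y g) := by
        unfold Doubling.join at hw; grind
      rcases hw' with hw' | ⟨rfl, hw'⟩
      · have := h₁.closed n han hnm g hF hw' d' g'
        unfold Doubling.join; grind
      -- The new face has level `i + 1`, and above level `i` the east side holds only ports; hence
      -- the bond is the message `west y` and none of the `bond` glues of the face.
      · obtain ⟨z, hz⟩ := h₁.east_level n han hnm.le g hF (by unfold WestFace at hw'; omega)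
        have : z = y := by unfold WestFace at hw'; grind
        subst this
        obtain ⟨j, σ⟩ := g
        simp only at hz
        subst hz
        have hj : (j : ℕ) = i + 1 := hw'.1
        simp only [Req, hj]
        unfold Doubling.join; grind
    · obtain ⟨h1, h2⟩ := join_closed_junction h₁ h₂ he hw
      simp only [Req, h1, h2]
      unfold Doubling.join; grind
    · have hF : F₂ (n + 1) .west g := by unfold Doubling.join at hw; grind
      have he' : F₂ n .east g ∨ (x = true ∧ EastFace (i + 1) y g) := by
        unfold Doubling.join at he; grind
      rcases he' with he' | ⟨rfl, he'⟩
      · have := h₂.closed n hnm hne g he' hF d' g'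
        unfold Doubling.join; grind
      · obtain ⟨z, hz⟩ := h₂.west_level (n + 1) (by omega) (by omega) g hF
          (by unfold EastFace at he'; omega)
        have : z = y := by unfold EastFace at he'; grind
        subst this
        obtain ⟨j, σ⟩ := g
        simp only at hz
        subst hz
        have hj : (j : ℕ) = i + 1 := he'.1
        simp only [Req, hj]
        unfold Doubling.join; grind

/-- Every closed set of glues that holds the eventual glues of the two parts holds those of the
joined line. -/
theorem Spec.join_le {F₁ F₂ : ℤ → Side → Glue k → Prop} {i : ℕ} {x y : Bool} {a m e : ℤ}
    (h₁ : Spec F₁ i true x a m) (h₂ : Spec F₂ i false y (m + 1) e) (ham : a ≤ m) (hme : m < e)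
    (hi : i < k) {O : ℤ → Side → Glue k → Prop} (hO : ClosedOn O a e)
    (hO₁ : ∀ n, a ≤ n → n ≤ m → ∀ d g, F₁ n d g → O n d g)
    (hO₂ : ∀ n, m < n → n ≤ e → ∀ d g, F₂ n d g → O n d g) :
    ∀ n, a ≤ n → n ≤ e → ∀ d g, Doubling.join F₁ F₂ i x y m n d g → O n d g := by
  let b : Glue k := (⟨i, hi⟩, .bond x y)
  have hb₁ : O m .east b := hO₁ m ham le_rfl _ _
    ((h₁.east_end b).2 ⟨rfl, rfl, .inr ⟨y, rfl⟩⟩)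
  have hb₂ : O (m + 1) .west b := hO₂ _ (by omega) (by omega) _ _
    ((h₂.west_end b).2 ⟨rfl, rfl, .inr ⟨x, rfl⟩⟩)
  have hb := hO m ham hme b hb₁ hb₂
  have hwest : x = false → ∀ n ≤ m, a ≤ n → ∀ g, WestFace (i + 1) y g → O n .west g := by
    intro hx n hn
    induction n, hn using Int.leInductionDown with
    | base => exact fun _ g hg => (hb .west g).1 (by simp [Req, b, hx, hg])
    | pred n hn ih =>
      intro han g hg
      -- The face contains a glue `g` of level `i + 1`, so that level exists. When `i + 1 = k` the
      -- faces are empty and no message is sent.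
      have hlt : i + 1 < k := hg.1 ▸ g.1.2
      have h := ih (by omega) (⟨i + 1, hlt⟩, .west y) ⟨rfl, .inl rfl⟩
      -- The message on the west side of `n` meets the port on the east side of `n - 1`, and closure
      -- moves the face one tile west.
      have h' := hO (n - 1) han (by omega) (⟨i + 1, hlt⟩, .west y)
        (hO₁ _ han (by omega) _ _ (h₁.east_port _ han (by omega) _ y (by simp) rfl))
        (by simpa using h)
      exact (h' .west g).1 (by simp [Req, hg])
  have heast : x = true → ∀ n, m + 1 ≤ n → n ≤ e → ∀ g, EastFace (i + 1) y g → O n .east g := by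
    intro hx n hn
    induction n, hn using Int.leInduction with
    | base => exact fun _ g hg => (hb .east g).2 (by simp [Req, b, hx, hg])
    | succ n hn ih =>
      intro hne g hg
      have hlt : i + 1 < k := hg.1 ▸ g.1.2
      have h := ih (by omega) (⟨i + 1, hlt⟩, .east y) ⟨rfl, .inl rfl⟩
      have h' := hO n (by omega) (by omega) (⟨i + 1, hlt⟩, .east y) h
        (hO₂ _ (by omega) (by omega) _ _
          (h₂.west_port _ (by omega) (by omega) _ y (by simp) rfl))
      exact (h' .east g).2 (by simp [Req, hg])
  intro n han hne d g hg
  rcases hg with ⟨hn, hg | ⟨rfl, rfl, hg⟩ | ⟨hx, rfl, hg⟩⟩ |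
    ⟨hn, hg | ⟨rfl, rfl, hg⟩ | ⟨hx, rfl, hg⟩⟩
  · exact hO₁ n han hn d g hg
  · exact (hb .east g).1 (by simp [Req, b, hg])
  · exact hwest hx n hn han g hg
  · exact hO₂ n hn hne d g hg
  · exact (hb .west g).2 (by simp [Req, b, hg])
  · exact heast hx n hn hne g hg

theorem Spec.shift {F : ℤ → Side → Glue k → Prop} {i : ℕ} {s x : Bool} {a e : ℤ}
    (h : Spec F i s x a e) (v : ℤ) : Spec (fun n => F (n - v)) i s x (a + v) (e + v) where
  horizontal n := h.horizontal (n - v)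
  east_level n h1 h2 := h.east_level (n - v) (by omega) (by omega)
  west_level n h1 h2 := h.west_level (n - v) (by omega) (by omega)
  east_port n h1 h2 := h.east_port (n - v) (by omega) (by omega)
  west_port n h1 h2 := h.west_port (n - v) (by omega) (by omega)
  east_end g := by simpa using h.east_end g
  west_end g := by simpa using h.west_end g
  closed n h1 h2 g he hw := by
    have := h.closed (n - v) (by omega) (by omega) g he
    rw [show n - v + 1 = n + 1 - v by ring] at this
    exact this hw

end Doubling

/-! ### Bonds and cuts of general placements -/

theorem Side.add_vec_opp (p : ℤ × ℤ) (d : Side) : p + d.vec + d.opp.vec = p := by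
  cases d <;> ext <;> simp [Side.vec, Side.opp]

@[simp] theorem Side.opp_opp (d : Side) : d.opp.opp = d := by cases d <;> rfl

section General

variable {Γ Λ : Type}

theorem fire_eq_some {c : Placement Γ Λ} {N : ℤ × ℤ → Side → Finset Γ} {p : ℤ × ℤ}
    {t : ActiveTile Γ Λ} :
    fire c N p = some t ↔ ∃ u, c p = some u ∧
      t = { u with pending := u.pending + ∑ d : Side, ∑ g ∈ N p d, (u.δ d g).val } := by
  unfold fire
  cases c p <;> simp [eq_comm]

theorem isSome_fire (c : Placement Γ Λ) (N : ℤ × ℤ → Side → Finset Γ) (p : ℤ × ℤ) :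
    (fire c N p).isSome = (c p).isSome := by
  simp [fire]

theorem mem_fire_pending {N : ℤ × ℤ → Side → Finset Γ} {p : ℤ × ℤ} {u : ActiveTile Γ Λ}
    {α : Action Γ Λ} :
    α ∈ u.pending + ∑ d : Side, ∑ g ∈ N p d, (u.δ d g).val ↔
      α ∈ u.pending ∨ ∃ d, ∃ g ∈ N p d, α ∈ u.δ d g := by
  simp [Multiset.mem_add, Multiset.mem_sum]

theorem union_eq_some {c c' : Placement Γ Λ} (hd : ∀ p, c p = none ∨ c' p = none) {p : ℤ × ℤ}
    {t : ActiveTile Γ Λ} : union c c' p = some t ↔ c p = some t ∨ c' p = some t := by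
  unfold union
  rcases hd p with h | h <;> simp [h]

theorem union_comm {c c' : Placement Γ Λ} (hd : ∀ p, c p = none ∨ c' p = none) :
    union c c' = union c' c := by
  funext p
  unfold union
  rcases hd p with h | h <;> simp [h]

variable [Fintype Γ]

theorem mem_onGlues {c : Placement Γ Λ} {p : ℤ × ℤ} {d : Side} {g : Γ} :
    g ∈ onGlues c p d ↔ ∃ t, c p = some t ∧ t.glue d g = some .on := by
  unfold onGlues
  cases c p <;> simp

theorem onGlues_fire (c : Placement Γ Λ) (N : ℤ × ℤ → Side → Finset Γ) :
    onGlues (fire c N) = onGlues c := by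
  ext p d g
  simp only [mem_onGlues, fire_eq_some]
  constructor
  · rintro ⟨t, ⟨u, hu, rfl⟩, h⟩; exact ⟨u, hu, h⟩
  · rintro ⟨u, hu, h⟩; exact ⟨_, ⟨u, hu, rfl⟩, h⟩

theorem mem_onGlues_union {c c' : Placement Γ Λ} (hd : ∀ p, c p = none ∨ c' p = none)
    {p : ℤ × ℤ} {d : Side} {g : Γ} :
    g ∈ onGlues (union c c') p d ↔ g ∈ onGlues c p d ∨ g ∈ onGlues c' p d := by
  simp only [mem_onGlues, union_eq_some hd]
  grind

variable [DecidableEq Γ]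

theorem mem_bonds {c : Placement Γ Λ} {p : ℤ × ℤ} {d : Side} {g : Γ} :
    g ∈ bonds c p d ↔ g ∈ onGlues c p d ∧ g ∈ onGlues c (p + d.vec) d.opp := by
  simp [bonds]

theorem mem_bonds_opp {c : Placement Γ Λ} {p : ℤ × ℤ} {d : Side} {g : Γ} :
    g ∈ bonds c (p + d.vec) d.opp ↔ g ∈ bonds c p d := by
  rw [mem_bonds, mem_bonds, Side.add_vec_opp, Side.opp_opp, and_comm]

theorem bonds_mono {c c' : Placement Γ Λ} (h : ∀ p d, onGlues c p d ⊆ onGlues c' p d)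
    (p : ℤ × ℤ) (d : Side) : bonds c p d ⊆ bonds c' p d :=
  Finset.inter_subset_inter (h _ _) (h _ _)

/-- With unit strengths the cut strength counts bonds, so at temperature 1 a single bond suffices.
-/
theorem one_le_cutStrength_iff {strength : Γ → ℤ} (hs : ∀ g, strength g = 1)
    {c : Placement Γ Λ} {X Y : Finset (ℤ × ℤ)} :
    1 ≤ cutStrength strength c X Y ↔
      ∃ p ∈ X, ∃ d : Side, p + d.vec ∈ Y ∧ (bonds c p d).Nonempty := by
  have key : ∀ p (d : Side),
      (if p + d.vec ∈ Y then ∑ g ∈ bonds c p d, strength g else 0) =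
        if p + d.vec ∈ Y then ((bonds c p d).card : ℤ) else 0 := by
    intro p d; simp [hs]
  have nn : ∀ p (d : Side), (0 : ℤ) ≤ if p + d.vec ∈ Y then ((bonds c p d).card : ℤ) else 0 := by
    intro p d; split <;> simp
  simp only [cutStrength, key]
  constructor
  · intro h
    obtain ⟨p, hp, h⟩ := Finset.exists_ne_zero_of_sum_ne_zero
      (show _ ≠ (0 : ℤ) from fun h0 => by rw [h0] at h; omega)
    obtain ⟨d, -, h⟩ := Finset.exists_ne_zero_of_sum_ne_zero h
    refine ⟨p, hp, d, ?_⟩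
    split at h
    · refine ⟨‹_›, Finset.card_ne_zero.1 (by exact_mod_cast h)⟩
    · exact absurd rfl h
  · rintro ⟨p, hp, d, hd, hb⟩
    have h1 : (1 : ℤ) ≤ if p + d.vec ∈ Y then ((bonds c p d).card : ℤ) else 0 := by
      rw [if_pos hd]; exact_mod_cast hb.card_pos
    refine h1.trans <| (Finset.single_le_sum (f := fun d : Side =>
      if p + d.vec ∈ Y then ((bonds c p d).card : ℤ) else 0) (fun d _ => nn p d)
      (Finset.mem_univ d)).trans ?_
    exact Finset.single_le_sum (f := fun p => ∑ d : Side,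
      if p + d.vec ∈ Y then ((bonds c p d).card : ℤ) else 0)
      (fun p _ => Finset.sum_nonneg fun d _ => nn p d) hp

theorem bonds_fire (c : Placement Γ Λ) (N : ℤ × ℤ → Side → Finset Γ) :
    bonds (fire c N) = bonds c := by
  funext p d; simp only [bonds, onGlues_fire]

end General

namespace Doubling

variable {k : ℕ}

/-! ### The invariant of a line -/

/-- A tile of the system, in a state compatible with the eventual glues `f`. -/
structure TileState (f : Side → Glue k → Prop) (t : ActiveTile (Glue k) (Bool × Bool)) :
    Prop where
  δ_eq : t.δ = delta k
  isSome_iff : ∀ d g, (t.glue d g).isSome = true ↔ d = .east ∨ d = .west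
  ne_off : ∀ d g, t.glue d g ≠ some .off
  on_le : ∀ d g, t.glue d g = some .on → f d g
  pending_le : ∀ α ∈ t.pending, ∃ d g, α = .glue d g .on ∧ f d g

theorem TileState.mono {f f' : Side → Glue k → Prop} {t : ActiveTile (Glue k) (Bool × Bool)}
    (h : TileState f t) (hf : ∀ d g, f d g → f' d g) : TileState f' t where
  δ_eq := h.δ_eq
  isSome_iff := h.isSome_iff
  ne_off := h.ne_off
  on_le d g hg := hf d g (h.on_le d g hg)
  pending_le α hα := by
    obtain ⟨d, g, rfl, hg⟩ := h.pending_le α hα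
    exact ⟨d, g, rfl, hf d g hg⟩

/-- `c` is a line of level `i` and kind `(s, x)` on the positions `[a, e] × {b}`, with eventual
glues `F`, in which all bonds outside `N` have fired. -/
structure LineState (c : Placement (Glue k) (Bool × Bool)) (N : ℤ × ℤ → Side → Finset (Glue k))
    (F : ℤ → Side → Glue k → Prop) (i : ℕ) (s x : Bool) (a e b : ℤ) : Prop where
  spec : Spec F i s x a e
  length : e + 1 = a + 2 ^ i
  level_le : i ≤ k
  dom : ∀ p, (c p).isSome = true ↔ a ≤ p.1 ∧ p.1 ≤ e ∧ p.2 = b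
  tile : ∀ n t, c (n, b) = some t → TileState (F n) t
  bonded : ∀ n, a ≤ n → n < e → (bonds c (n, b) .east).Nonempty
  fired : ∀ n d g t, c (n, b) = some t → g ∈ bonds c (n, b) d → g ∈ N (n, b) d ∨
    ∀ d' g', Req d g d' g' → t.glue d' g' = some .on ∨ .glue d' g' .on ∈ t.pending
  complete : ∀ O, (∀ n d g, g ∈ onGlues c (n, b) d → O n d g) → ClosedOn O a e →
    ∀ n, a ≤ n → n ≤ e → ∀ d g, F n d g → O n d g

section LineState

variable {c : Placement (Glue k) (Bool × Bool)} {N : ℤ × ℤ → Side → Finset (Glue k)}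
  {F : ℤ → Side → Glue k → Prop} {i : ℕ} {s x : Bool} {a e b : ℤ}

theorem LineState.le (h : LineState c N F i s x a e b) : a ≤ e := by
  have := h.length
  have : (0 : ℤ) < 2 ^ i := by positivity
  omega

theorem LineState.of_eq_some (h : LineState c N F i s x a e b) {p : ℤ × ℤ}
    {t : ActiveTile (Glue k) (Bool × Bool)} (ht : c p = some t) :
    a ≤ p.1 ∧ p.1 ≤ e ∧ p.2 = b := (h.dom p).1 (by simp [ht])

theorem LineState.of_mem_onGlues (h : LineState c N F i s x a e b) {p : ℤ × ℤ} {d : Side}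
    {g : Glue k} (hg : g ∈ onGlues c p d) :
    a ≤ p.1 ∧ p.1 ≤ e ∧ p.2 = b ∧ (d = .east ∨ d = .west) ∧ F p.1 d g := by
  obtain ⟨t, ht, hg⟩ := mem_onGlues.1 hg
  obtain ⟨h1, h2, h3⟩ := h.of_eq_some ht
  have ht' : c (p.1, b) = some t := by rw [← h3]; exact ht
  have := (h.tile _ _ ht').on_le d g hg
  exact ⟨h1, h2, h3, h.spec.horizontal _ _ _ this, this⟩

/-- The requests of a bond concern eventual glues. -/
theorem LineState.req_le (h : LineState c N F i s x a e b) {n : ℤ} {d d' : Side} {g g' : Glue k}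
    (hg : g ∈ bonds c (n, b) d) (hr : Req d g d' g') : F n d' g' := by
  obtain ⟨h1, h2⟩ := mem_bonds.1 hg
  obtain ⟨a1, a2, -, hd, hF⟩ := h.of_mem_onGlues h1
  obtain ⟨b1, b2, -, -, hF'⟩ := h.of_mem_onGlues h2
  rcases hd with rfl | rfl
  · simp only [Side.vec, Side.opp, Prod.fst_add] at *
    exact (h.spec.closed n a1 (by omega) g hF hF' d' g').1 hr
  · simp only [Side.vec, Side.opp, Prod.fst_add] at *
    have := (h.spec.closed (n + -1) b1 (by omega) g hF' (by simpa using hF) d' g').2 hr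
    simpa using this

/-- Firing changes only the pending multisets, and by `LineState.req_le` the added actions concern
eventual glues. It discharges the unfired bonds `N` left by `LineState.union` and
`LineState.turnOn`. -/
theorem LineState.fire (h : LineState c N F i s x a e b) (hN : ∀ p d, N p d ⊆ bonds c p d) :
    LineState (fire c N) (fun _ _ => ∅) F i s x a e b where
  spec := h.spec
  length := h.length
  level_le := h.level_le
  dom p := by rw [isSome_fire]; exact h.dom p
  tile n t ht := by
    obtain ⟨u, hu, rfl⟩ := fire_eq_some.1 ht
    have hT := h.tile n u hu
    refine ⟨hT.δ_eq, hT.isSome_iff, hT.ne_off, hT.on_le, fun α hα => ?_⟩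
    rcases mem_fire_pending.1 hα with hα | ⟨d, g, hg, hα⟩
    · exact hT.pending_le α hα
    · rw [hT.δ_eq, mem_delta] at hα
      obtain ⟨d', g', hr, rfl⟩ := hα
      exact ⟨d', g', rfl, h.req_le (hN _ _ hg) hr⟩
  bonded n h1 h2 := by rw [bonds_fire]; exact h.bonded n h1 h2
  fired n d g t ht hg := by
    obtain ⟨u, hu, rfl⟩ := fire_eq_some.1 ht
    rw [bonds_fire] at hg
    refine .inr fun d' g' hr => ?_
    simp only [mem_fire_pending]
    rcases h.fired n d g u hu hg with hg | hg
    · refine .inr (.inr ⟨d, g, hg, ?_⟩)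
      rw [(h.tile n u hu).δ_eq, mem_delta]
      exact ⟨d', g', hr, rfl⟩
    · rcases hg d' g' hr with h | h
      · exact .inl h
      · exact .inr (.inl h)
  complete O hO := h.complete O (by simpa only [onGlues_fire] using hO)

/-- Consecutive tiles of a line are bound, so that no cut is free of bonds. -/
theorem LineState.stable {A : Supertile (Glue k) (Bool × Bool)} {strength : Glue k → ℤ}
    (hs : ∀ g, strength g = 1) (h : LineState A.tile N F i s x a e b) : Stable strength 1 A := by
  rintro X Y ⟨⟨p, hp⟩, ⟨q, hq⟩, hXY, hU⟩
  rw [Nat.cast_one, one_le_cutStrength_iff hs]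
  have hdom : ∀ r, r ∈ A.dom ↔ a ≤ r.1 ∧ r.1 ≤ e ∧ r.2 = b := fun r =>
    (A.mem_dom r).trans (h.dom r)
  have hmem : ∀ r, r ∈ A.dom ↔ r ∈ X ∨ r ∈ Y := fun r => by rw [← hU, Finset.mem_union]
  by_contra hno
  push Not at hno
  -- If no bond crosses the cut, membership in `X` passes between neighbours, so it is constant
  -- along the line and `Y` would be empty.
  have step : ∀ n, a ≤ n → n < e → ((n, b) ∈ X ↔ (n + 1, b) ∈ X) := by
    intro n h1 h2
    have hb := h.bonded n h1 h2
    have hn := (hmem _).1 ((hdom (n, b)).2 ⟨h1, h2.le, rfl⟩)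
    have hn' := (hmem _).1 ((hdom (n + 1, b)).2 ⟨by simp; omega, by simp; omega, rfl⟩)
    have hv : ((n, b) : ℤ × ℤ) + Side.east.vec = (n + 1, b) := by simp [Side.vec]
    have hv' : ((n + 1, b) : ℤ × ℤ) + Side.west.vec = (n, b) := by simp [Side.vec]
    have hb' : (bonds A.tile (n + 1, b) .west).Nonempty := by
      obtain ⟨g, hg⟩ := hb
      refine ⟨g, ?_⟩
      rw [← hv]; exact mem_bonds_opp.2 hg
    constructor
    · intro hX
      by_contra hX'
      have := hno _ hX .east (by rw [hv]; exact hn'.resolve_left hX')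
      exact hb.ne_empty this
    · intro hX
      by_contra hX'
      have := hno _ hX .west (by rw [hv']; exact hn.resolve_left hX')
      exact hb'.ne_empty this
  have all : ∀ n, a ≤ n → n ≤ e → ((n, b) ∈ X ↔ (a, b) ∈ X) := by
    intro n hn
    induction n, hn using Int.leInduction with
    | base => simp
    | succ n hn ih => intro hne; rw [← step n hn (by omega)]; exact ih (by omega)
  obtain ⟨p1, p2, p3⟩ := (hdom p).1 ((hmem p).2 (.inl hp))
  obtain ⟨q1, q2, q3⟩ := (hdom q).1 ((hmem q).2 (.inr hq))
  have e1 : (p.1, b) = p := by rw [← p3]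
  have e2 : (q.1, b) = q := by rw [← q3]
  have hp' := (all p.1 p1 p2).1 (by rwa [e1])
  have hq' := (all q.1 q1 q2).2 hp'
  rw [e2] at hq'
  exact Finset.disjoint_left.1 hXY hq' hq

theorem LineState.shift (h : LineState c (fun _ _ => ∅) F i s x a e b) (v : ℤ × ℤ) :
    LineState (shift v c) (fun _ _ => ∅) (fun n => F (n - v.1)) i s x (a + v.1) (e + v.1)
      (b + v.2) := by
  have hon : ∀ p d, onGlues (STAM.shift v c) p d = onGlues c (p - v) d := fun p d => rfl
  have hbd : ∀ p d, bonds (STAM.shift v c) p d = bonds c (p - v) d := fun p d => by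
    simp only [bonds, hon, add_sub_right_comm]
  have hpos : ∀ n : ℤ, ((n, b + v.2) : ℤ × ℤ) - v = (n - v.1, b) := fun n => by
    ext <;> simp
  refine ⟨h.spec.shift v.1, by have := h.length; omega, h.level_le, fun p => ?_,
    fun n t ht => ?_, fun n h1 h2 => ?_, fun n d g t ht hg => ?_, fun O hO hcl n h1 h2 d g hg => ?_⟩
  · refine (h.dom (p - v)).trans ?_
    simp only [Prod.fst_sub, Prod.snd_sub]
    omega
  · refine h.tile (n - v.1) t ?_
    rw [← hpos]; exact ht
  · rw [hbd, hpos]; exact h.bonded _ (by omega) (by omega)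
  · rw [hbd, hpos] at hg
    refine h.fired (n - v.1) d g t ?_ hg
    rw [← hpos]; exact ht
  · have := h.complete (fun n => O (n + v.1)) (fun n d g hg => hO _ _ _ ?_) ?_ (n - v.1)
      (by omega) (by omega) d g hg
    · simpa using this
    · rw [hon, hpos]; simpa using hg
    · intro n h1 h2 g he hw
      simp only [show n + 1 + v.1 = n + v.1 + 1 by ring] at hw ⊢
      exact hcl (n + v.1) (by omega) (by omega) g he hw

end LineState

/-- Bonds inside either part have already fired, so the unfired ones are exactly the new bonds.
Minimality of the joined set comes from that of the two parts through `Spec.join_le`. -/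
theorem LineState.union {c₁ c₂ : Placement (Glue k) (Bool × Bool)}
    {F₁ F₂ : ℤ → Side → Glue k → Prop} {i : ℕ} {x y : Bool} {a m e b : ℤ}
    (h₁ : LineState c₁ (fun _ _ => ∅) F₁ i true x a m b)
    (h₂ : LineState c₂ (fun _ _ => ∅) F₂ i false y (m + 1) e b) (hi : i < k)
    (hd : ∀ p, c₁ p = none ∨ c₂ p = none)
    (hb : (bonds (union c₁ c₂) (m, b) .east).Nonempty) :
    LineState (union c₁ c₂)
      (fun p d => bonds (union c₁ c₂) p d \ (bonds c₁ p d ∪ bonds c₂ p d))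
      (join F₁ F₂ i x y m) (i + 1) x y a e b := by
  have ham := h₁.le
  have hme := h₂.le
  have hon := fun (p : ℤ × ℤ) (d : Side) (g : Glue k) =>
    mem_onGlues_union (c := c₁) (c' := c₂) hd (p := p) (d := d) (g := g)
  refine ⟨h₁.spec.join h₂.spec ham (by omega), ?_, hi, fun p => ?_, fun n t ht => ?_,
    fun n h1 h2 => ?_, fun n d g t ht hg => ?_, fun O hO hcl => ?_⟩
  · have := h₁.length
    have := h₂.length
    rw [pow_succ]; omega
  · have e1 := h₁.dom p
    have e2 := h₂.dom p
    have : (STAM.union c₁ c₂ p).isSome = true ↔ (c₁ p).isSome = true ∨ (c₂ p).isSome = true := by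
      simp [STAM.union]
    rw [this, e1, e2]
    omega
  · rcases (union_eq_some hd).1 ht with ht | ht
    · have := (h₁.of_eq_some ht).2.1
      exact (h₁.tile n t ht).mono fun d g hg => .inl ⟨this, .inl hg⟩
    · have := (h₂.of_eq_some ht).1
      exact (h₂.tile n t ht).mono fun d g hg => .inr ⟨by simpa using this, .inl hg⟩
  · rcases lt_trichotomy n m with h | rfl | h
    · exact (h₁.bonded n h1 h).mono (bonds_mono (fun p d g hg => (hon p d g).2 (.inl hg)) _ _)
    · exact hb
    · exact (h₂.bonded n h h2).mono (bonds_mono (fun p d g hg => (hon p d g).2 (.inr hg)) _ _)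
  · by_cases hN : g ∈ bonds c₁ (n, b) d ∪ bonds c₂ (n, b) d
    · right
      rcases Finset.mem_union.1 hN with hN | hN
      · obtain ⟨u, hu, -⟩ := mem_onGlues.1 (mem_bonds.1 hN).1
        have := (union_eq_some (c := c₁) (c' := c₂) hd).2 (.inl hu)
        obtain rfl : t = u := by rw [ht] at this; exact Option.some.inj this
        exact (h₁.fired n d g t hu hN).resolve_left (by simp)
      · obtain ⟨u, hu, -⟩ := mem_onGlues.1 (mem_bonds.1 hN).1
        have := (union_eq_some (c := c₁) (c' := c₂) hd).2 (.inr hu)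
        obtain rfl : t = u := by rw [ht] at this; exact Option.some.inj this
        exact (h₂.fired n d g t hu hN).resolve_left (by simp)
    · exact .inl (Finset.mem_sdiff.2 ⟨hg, hN⟩)
  · refine h₁.spec.join_le h₂.spec ham (by omega) hi hcl ?_ ?_
    · exact h₁.complete O (fun n d g hg => hO n d g ((hon _ _ _).2 (.inl hg)))
        fun n h1 h2 => hcl n h1 (by omega)
    · exact h₂.complete O (fun n d g hg => hO n d g ((hon _ _ _).2 (.inr hg)))
        fun n h1 h2 => hcl n (by omega) h2

/-- Two lines that bind are neighbours of the same level and of opposite kinds. -/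
theorem LineState.touch {c₁ c₂ : Placement (Glue k) (Bool × Bool)}
    {F₁ F₂ : ℤ → Side → Glue k → Prop} {i₁ i₂ : ℕ} {s₁ s₂ x₁ x₂ : Bool} {a₁ a₂ e₁ e₂ b₁ b₂ : ℤ}
    (h₁ : LineState c₁ (fun _ _ => ∅) F₁ i₁ s₁ x₁ a₁ e₁ b₁)
    (h₂ : LineState c₂ (fun _ _ => ∅) F₂ i₂ s₂ x₂ a₂ e₂ b₂)
    (hd : ∀ p, c₁ p = none ∨ c₂ p = none) {p : ℤ × ℤ} {d : Side} (hp : (c₁ p).isSome = true)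
    (hq : (c₂ (p + d.vec)).isSome = true) (hb : (bonds (STAM.union c₁ c₂) p d).Nonempty) :
    i₁ = i₂ ∧ i₁ < k ∧ b₁ = b₂ ∧
      ((s₁ = true ∧ s₂ = false ∧ a₂ = e₁ + 1 ∧ (bonds (STAM.union c₁ c₂) (e₁, b₁) .east).Nonempty) ∨
        (s₁ = false ∧ s₂ = true ∧ a₁ = e₂ + 1 ∧
          (bonds (STAM.union c₁ c₂) (e₂, b₁) .east).Nonempty)) := by
  obtain ⟨g, hg⟩ := id hb
  obtain ⟨hg₁, hg₂⟩ := mem_bonds.1 hg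
  rw [mem_onGlues_union hd] at hg₁ hg₂
  have hp2 : c₂ p = none := (hd p).resolve_left fun h => by simp [h] at hp
  have hq1 : c₁ (p + d.vec) = none := (hd _).resolve_right fun h => by simp [h] at hq
  replace hg₁ : g ∈ onGlues c₁ p d := hg₁.resolve_right fun h => by
    obtain ⟨t, ht, -⟩ := mem_onGlues.1 h; simp [hp2] at ht
  replace hg₂ : g ∈ onGlues c₂ (p + d.vec) d.opp := hg₂.resolve_left fun h => by
    obtain ⟨t, ht, -⟩ := mem_onGlues.1 h; simp [hq1] at ht
  obtain ⟨p1, p2, p3, hE, hF₁⟩ := h₁.of_mem_onGlues hg₁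
  obtain ⟨q1, q2, q3, -, hF₂⟩ := h₂.of_mem_onGlues hg₂
  have hp2' := (h₂.dom p).not.1 (by simp [hp2])
  have hq1' := (h₁.dom (p + d.vec)).not.1 (by simp [hq1])
  obtain ⟨n, b⟩ := p
  rcases hE with rfl | rfl
  · simp only [Side.vec, Side.opp, Prod.fst_add, Prod.snd_add, add_zero] at *
    subst p3
    obtain rfl : b₂ = b := q3.symm
    -- The eastern neighbour lies outside the first line, so the bond sits at its east end.
    obtain rfl : n = e₁ := by omega
    obtain rfl : a₂ = n + 1 := by omega
    obtain ⟨rfl, hf₁⟩ := (h₁.spec.east_end g).1 hF₁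
    obtain ⟨rfl, hf₂⟩ := (h₂.spec.west_end g).1 hF₂
    -- Both faces contain the same glue, whose single level equals `i₁` and `i₂` and is below `k`.
    refine ⟨hf₁.1.symm.trans hf₂.1, hf₁.1 ▸ g.1.2, rfl, .inl ⟨rfl, rfl, rfl, hb⟩⟩
  · simp only [Side.vec, Side.opp, Prod.fst_add, Prod.snd_add, add_zero] at *
    subst p3
    obtain rfl : b₂ = b := q3.symm
    obtain rfl : n = a₁ := by omega
    obtain rfl : e₂ = n + -1 := by omega
    obtain ⟨rfl, hf₁⟩ := (h₁.spec.west_end g).1 hF₁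
    obtain ⟨rfl, hf₂⟩ := (h₂.spec.east_end g).1 hF₂
    refine ⟨hf₁.1.symm.trans hf₂.1, hf₁.1 ▸ g.1.2, rfl, .inr ⟨rfl, rfl, by ring, g, ?_⟩⟩
    have := mem_bonds_opp.2 hg
    simpa [Side.vec, Side.opp] using this

/-! ### Lines under combination, transitions and breaks -/

/-- `A` is a line of level `i` and kind `(s, x)`. -/
def IsLine (A : Supertile (Glue k) (Bool × Bool)) (i : ℕ) (s x : Bool) : Prop :=
  ∃ F a e b, LineState A.tile (fun _ _ => ∅) F i s x a e b

theorem IsLine.stable {A : Supertile (Glue k) (Bool × Bool)} {i : ℕ} {s x : Bool}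
    {strength : Glue k → ℤ} (hs : ∀ g, strength g = 1) (h : IsLine A i s x) :
    Stable strength 1 A := by
  obtain ⟨F, a, e, b, h⟩ := h
  exact h.stable hs

theorem IsLine.combine {A B C : Supertile (Glue k) (Bool × Bool)} {i₁ i₂ : ℕ}
    {s₁ s₂ x₁ x₂ : Bool} {strength : Glue k → ℤ} (hs : ∀ g, strength g = 1)
    (hA : IsLine A i₁ s₁ x₁) (hB : IsLine B i₂ s₂ x₂) (h : Combines strength 1 A B C) :
    (s₁ = true ∧ s₂ = false ∧ IsLine C (i₁ + 1) x₁ x₂) ∨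
      (s₁ = false ∧ s₂ = true ∧ IsLine C (i₁ + 1) x₂ x₁) := by
  obtain ⟨F₁, a₁, e₁, b₁, h₁⟩ := hA
  obtain ⟨F₂, a₂, e₂, b₂, h₂⟩ := hB
  obtain ⟨-, -, v, hdis, hcut, hC⟩ := h
  have h₂' := h₂.shift v
  have hY : ∀ p, p ∈ B.dom.image (fun p => p + v) ↔ (shift v B.tile p).isSome = true := by
    intro p
    simp only [Finset.mem_image, shift, ← B.mem_dom]
    constructor
    · rintro ⟨q, hq, rfl⟩; simpa using hq
    · exact fun hp => ⟨_, hp, by simp⟩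
  have hd : ∀ p, A.tile p = none ∨ shift v B.tile p = none := by
    intro p
    by_contra! hp
    refine Finset.disjoint_left.1 hdis ((A.mem_dom p).2 ?_) ((hY p).2 ?_)
    · exact Option.isSome_iff_ne_none.2 hp.1
    · exact Option.isSome_iff_ne_none.2 hp.2
  rw [Nat.cast_one, one_le_cutStrength_iff hs] at hcut
  obtain ⟨p, hp, d, hq, hb⟩ := hcut
  obtain ⟨rfl, hi, hbb, ⟨rfl, rfl, ha, hb'⟩ | ⟨rfl, rfl, ha, hb'⟩⟩ :=
    h₁.touch h₂' hd ((A.mem_dom p).1 hp) ((hY _).1 hq) hb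
  · left
    rw [ha, ← hbb] at h₂'
    have h := (h₁.union h₂' hi hd hb').fire fun p d => Finset.sdiff_subset
    rw [← hC] at h
    exact ⟨rfl, rfl, _, _, _, _, h⟩
  · right
    rw [ha] at h₁
    rw [← hbb] at h₂'
    -- Here `B` is the left part, so the union is rewritten with the roles exchanged.
    simp only [union_comm hd, Finset.union_comm (bonds A.tile _ _)] at hb' hC
    have h := (h₂'.union h₁ hi (fun p => (hd p).symm) hb').fire fun p d => Finset.sdiff_subset
    rw [← hC] at h
    exact ⟨rfl, rfl, _, _, _, _, h⟩

/-- The placement in which the glue `g` on side `d` of the tile `t` at `p` has been turned on, and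
the pending actions of that tile replaced by `rest`. -/
def turnOn (c : Placement (Glue k) (Bool × Bool)) (p : ℤ × ℤ)
    (t : ActiveTile (Glue k) (Bool × Bool)) (d : Side) (g : Glue k)
    (rest : Multiset (Action (Glue k) (Bool × Bool))) : Placement (Glue k) (Bool × Bool) :=
  fun p' => if p' = p then
    some { t with
      glue := fun d' g' => if d' = d ∧ g' = g then some .on else t.glue d' g'
      pending := rest } else c p'

theorem mem_onGlues_turnOn {c : Placement (Glue k) (Bool × Bool)} {p : ℤ × ℤ}
    {t : ActiveTile (Glue k) (Bool × Bool)} {d : Side} {g : Glue k}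
    {rest : Multiset (Action (Glue k) (Bool × Bool))} (ht : c p = some t) {p' : ℤ × ℤ} {d' : Side}
    {g' : Glue k} :
    g' ∈ onGlues (turnOn c p t d g rest) p' d' ↔
      g' ∈ onGlues c p' d' ∨ (p' = p ∧ d' = d ∧ g' = g) := by
  simp only [mem_onGlues, turnOn]
  by_cases hp : p' = p
  · subst hp
    simp only [if_true, ht, Option.some.injEq, exists_eq_left', true_and]
    split <;> simp_all
  · simp [hp]

/-- A pending action concerns an eventual glue, so the glues that are on remain within `F`. A
request of an old bond that disappears from the pending multiset is the glue just turned on. -/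
theorem LineState.turnOn {c : Placement (Glue k) (Bool × Bool)} {F : ℤ → Side → Glue k → Prop}
    {i : ℕ} {s x : Bool} {a e b : ℤ} (h : LineState c (fun _ _ => ∅) F i s x a e b) {p : ℤ × ℤ}
    {t : ActiveTile (Glue k) (Bool × Bool)} {d : Side} {g : Glue k}
    {rest : Multiset (Action (Glue k) (Bool × Bool))} (ht : c p = some t)
    (hpend : t.pending = .glue d g .on ::ₘ rest) :
    LineState (turnOn c p t d g rest)
      (fun p' d' => bonds (Doubling.turnOn c p t d g rest) p' d' \ bonds c p' d')
      F i s x a e b := by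
  have hon := fun (p' : ℤ × ℤ) (d' : Side) (g' : Glue k) =>
    mem_onGlues_turnOn (d := d) (g := g) (rest := rest) ht (p' := p') (d' := d') (g' := g')
  have hmono := bonds_mono (c := c) (c' := Doubling.turnOn c p t d g rest)
    fun p d g hg => (hon p d g).2 (.inl hg)
  obtain ⟨n₀, b₀⟩ := p
  obtain rfl : b₀ = b := (h.of_eq_some ht).2.2
  have hT := h.tile n₀ t ht
  have hF : F n₀ d g := by
    obtain ⟨d', g', he, hf⟩ := hT.pending_le (.glue d g .on) (by simp [hpend])
    simp only [Action.glue.injEq, and_true] at he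
    obtain ⟨rfl, rfl⟩ := he
    exact hf
  refine ⟨h.spec, h.length, h.level_le, fun p => ?_, fun n u hu => ?_, fun n h1 h2 => ?_,
    fun n d' g' u hu hg' => ?_, fun O hO => h.complete O fun n d g hg => hO n d g ?_⟩
  · rw [← h.dom p]
    unfold Doubling.turnOn
    split
    · rename_i hp; simp [hp, ht]
    · rfl
  · unfold Doubling.turnOn at hu
    split at hu
    · rename_i hn
      obtain rfl : n = n₀ := congrArg Prod.fst hn
      obtain rfl := Option.some.inj hu
      refine ⟨hT.δ_eq, fun d' g' => ?_, fun d' g' => ?_, fun d' g' hg' => ?_,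
        fun α hα => hT.pending_le α (by simp at hα; simp [hpend, hα])⟩
      · have := hT.isSome_iff d' g'
        have := h.spec.horizontal _ _ _ hF
        dsimp only
        split <;> simp_all
      · have := hT.ne_off d' g'
        dsimp only
        split <;> simp_all
      · have := hT.on_le d' g'
        dsimp only at hg'
        split at hg' <;> simp_all
    · exact h.tile n u hu
  · exact (h.bonded n h1 h2).mono (hmono _ _)
  · by_cases hb : g' ∈ bonds c (n, b₀) d'
    · right
      intro d'' g'' hr
      unfold Doubling.turnOn at hu
      split at hu
      · rename_i hn
        obtain rfl : n = n₀ := congrArg Prod.fst hn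
        obtain rfl := Option.some.inj hu
        have := (h.fired n d' g' t ht hb).resolve_left (by simp) d'' g'' hr
        rw [hpend, Multiset.mem_cons] at this
        simp only [Action.glue.injEq, and_true] at this
        dsimp only
        by_cases hc : d'' = d ∧ g'' = g
        · simp [hc]
        · rw [if_neg hc]; tauto
      · exact (h.fired n d' g' u hu hb).resolve_left (by simp) d'' g'' hr
    · exact .inl (Finset.mem_sdiff.2 ⟨hg', hb⟩)
  · exact (hon _ _ _).2 (.inl hg)

/-- A pending action of a line turns a glue on. -/
theorem LineState.eq_turnOn {A B : Supertile (Glue k) (Bool × Bool)}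
    {F : ℤ → Side → Glue k → Prop} {i : ℕ} {s x : Bool} {a e b : ℤ}
    (h : LineState A.tile (fun _ _ => ∅) F i s x a e b) (hAB : GlueTransition A B) :
    ∃ p t d g rest, A.tile p = some t ∧ t.pending = .glue d g .on ::ₘ rest ∧
      B.tile = STAM.fire (Doubling.turnOn A.tile p t d g rest)
        (fun p' d' => bonds (Doubling.turnOn A.tile p t d g rest) p' d' \
          bonds A.tile p' d') := by
  obtain ⟨p, t, d, g, sw, q, rest, ht, hq, hpend, hB⟩ := hAB
  have hb := (h.of_eq_some ht).2.2
  have hT := h.tile p.1 t (by rw [← hb]; exact ht)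
  obtain ⟨d', g', he, -⟩ := hT.pending_le (.glue d g sw) (by simp [hpend])
  simp only [Action.glue.injEq] at he
  obtain ⟨-, -, rfl⟩ := he
  have hq' : q.next .on = .on := by
    have := hT.ne_off d g
    rw [hq] at this
    cases q <;> simp_all [GState.next]
  refine ⟨p, t, d, g, rest, ht, hpend, ?_⟩
  simp only [hq'] at hB
  exact hB

theorem IsLine.glueTransition {A B : Supertile (Glue k) (Bool × Bool)} {i : ℕ} {s x : Bool}
    (hA : IsLine A i s x) (hAB : GlueTransition A B) : IsLine B i s x := by
  obtain ⟨F, a, e, b, h⟩ := hA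
  obtain ⟨p, t, d, g, rest, ht, hpend, hB⟩ := h.eq_turnOn hAB
  refine ⟨F, a, e, b, ?_⟩
  rw [hB]
  exact (h.turnOn ht hpend).fire fun p d => Finset.sdiff_subset

theorem IsLine.not_labelTransition {A B : Supertile (Glue k) (Bool × Bool)} {i : ℕ} {s x : Bool}
    (hA : IsLine A i s x) : ¬ LabelTransition A B := by
  obtain ⟨F, a, e, b, h⟩ := hA
  rintro ⟨p, t, t', y, sw, q, rest, ht, -, hpend, -⟩
  have hb := (h.of_eq_some ht).2.2
  obtain ⟨d, g, he, -⟩ := (h.tile p.1 t (by rw [← hb]; exact ht)).pending_le (.label y sw)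
    (by simp [hpend])
  simp at he

theorem IsLine.not_breaks {A B C : Supertile (Glue k) (Bool × Bool)} {i : ℕ} {s x : Bool}
    {strength : Glue k → ℤ} (hs : ∀ g, strength g = 1) (hA : IsLine A i s x) :
    ¬ Breaks strength 1 A B C := by
  rintro ⟨X, Y, hXY, hlt, -⟩
  exact absurd (hA.stable hs X Y hXY) (not_le.2 hlt)

theorem IsLine.single (κ : Bool × Bool) : IsLine (Supertile.single (tile k κ)) 0 κ.1 κ.2 := by
  have hon : ∀ p d g, g ∈ onGlues (Supertile.single (tile k κ)).tile p d ↔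
      p = (0, 0) ∧ Init κ d g := by
    intro p d g
    rw [mem_onGlues]
    by_cases hp : p = (0, 0)
    · simp only [Supertile.single, hp, if_true, Option.some.injEq, exists_eq_left', true_and, tile]
      have := (Spec.leaf (k := k) κ 0).horizontal 0 d g
      grind
    · simp [Supertile.single, hp]
  have hbd : ∀ p d g, g ∉ bonds (Supertile.single (tile k κ)).tile p d := by
    intro p d g hg
    rw [mem_bonds, hon, hon] at hg
    obtain ⟨⟨rfl, -⟩, h, -⟩ := hg
    cases d <;> simp [Side.vec] at h
  refine ⟨_, 0, 0, 0, Spec.leaf κ 0, by simp, Nat.zero_le _, fun p => ?_, fun n t ht => ?_,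
    fun n h1 h2 => by omega, fun n d g t _ hg => absurd hg (hbd _ _ _),
    fun O hO _ n h1 h2 d g hg => hO n d g ((hon _ _ _).2 ⟨?_, hg⟩)⟩
  · rw [← Supertile.mem_dom]
    simp only [Supertile.single, Finset.mem_singleton, Prod.ext_iff]
    omega
  · simp only [Supertile.single] at ht
    split at ht
    · obtain rfl := Option.some.inj ht
      refine ⟨rfl, fun d g => ?_, fun d g => ?_, fun d g => ?_, fun α hα => by simp [tile] at hα⟩
      · simp only [tile]; split <;> simp_all
      · simp only [tile]; grind
      · simp only [tile]; grind
    · simp at ht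
  · obtain rfl : n = 0 := by omega
    rfl

/-! ### The system and its producible supertiles -/

/-- The signal tile assembly system for the line of length `2 ^ k`. -/
noncomputable def system (k : ℕ) : System (Glue k) (Bool × Bool) where
  strength _ := 1
  initial := Set.range fun κ => Supertile.single (tile k κ)
  temperature := 1
  initial_finite := Set.finite_range _
  temperature_pos := one_pos
  initial_pending := by
    rintro _ ⟨κ, rfl⟩ p t ht
    simp only [Supertile.single] at ht
    split at ht
    · obtain rfl := Option.some.inj ht; rfl
    · simp at ht
  initial_state := by
    rintro _ ⟨κ, rfl⟩ p t ht d g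
    simp only [Supertile.single] at ht
    split at ht
    · obtain rfl := Option.some.inj ht
      simp only [tile]; grind
    · simp at ht

theorem isLine_of_producible {A : Supertile (Glue k) (Bool × Bool)}
    (hA : (system k).Producible A) : ∃ i s x, IsLine A i s x := by
  induction hA with
  | base h =>
    obtain ⟨κ, rfl⟩ := h
    exact ⟨_, _, _, IsLine.single κ⟩
  | combine _ _ hC ihA ihB =>
    obtain ⟨i, s, x, hA⟩ := ihA
    obtain ⟨j, r, y, hB⟩ := ihB
    rcases hA.combine (fun _ => rfl) hB hC with ⟨-, -, h⟩ | ⟨-, -, h⟩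
    · exact ⟨_, _, _, h⟩
    · exact ⟨_, _, _, h⟩
  | break_left _ h ih =>
    obtain ⟨i, s, x, hA⟩ := ih
    exact absurd h (hA.not_breaks fun _ => rfl)
  | break_right _ h ih =>
    obtain ⟨i, s, x, hA⟩ := ih
    exact absurd h (hA.not_breaks fun _ => rfl)
  | glue _ h ih =>
    obtain ⟨i, s, x, hA⟩ := ih
    exact ⟨i, s, x, hA.glueTransition h⟩
  | label _ h ih =>
    obtain ⟨i, s, x, hA⟩ := ih
    exact absurd h hA.not_labelTransition

/-! ### Exhaustion of pending actions -/

/-- No action is pending on any tile of `A`. -/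
def Quiet (A : Supertile (Glue k) (Bool × Bool)) : Prop :=
  ∀ p t, A.tile p = some t → t.pending = 0

/-- The number of latent glues of a tile. -/
def latentCount (o : Option (ActiveTile (Glue k) (Bool × Bool))) : ℕ :=
  match o with
  | some t => (Finset.univ.filter fun q : Side × Glue k => t.glue q.1 q.2 = some .latent).card
  | none => 0

/-- The number of pending actions of a tile. -/
def pendingCount (o : Option (ActiveTile (Glue k) (Bool × Bool))) : ℕ :=
  match o with
  | some t => t.pending.card
  | none => 0

theorem latentCount_fire (c : Placement (Glue k) (Bool × Bool))
    (N : ℤ × ℤ → Side → Finset (Glue k)) (p : ℤ × ℤ) :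
    latentCount (fire c N p) = latentCount (c p) := by
  unfold fire
  cases c p <;> rfl

/-- Executing a pending action of a line decreases, lexicographically, the numbers of latent
glues and of pending actions. -/
theorem IsLine.exists_lt {A : Supertile (Glue k) (Bool × Bool)} {i : ℕ} {s x : Bool}
    (hA : IsLine A i s x) (hq : ¬ Quiet A) :
    ∃ B : Supertile (Glue k) (Bool × Bool), GlueTransition A B ∧ B.dom = A.dom ∧
      (∑ p ∈ B.dom, latentCount (B.tile p) < ∑ p ∈ A.dom, latentCount (A.tile p) ∨
        (∑ p ∈ B.dom, latentCount (B.tile p) = ∑ p ∈ A.dom, latentCount (A.tile p) ∧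
          ∑ p ∈ B.dom, pendingCount (B.tile p) < ∑ p ∈ A.dom, pendingCount (A.tile p))) := by
  obtain ⟨F, a, e, b, h⟩ := hA
  unfold Quiet at hq
  push Not at hq
  obtain ⟨p, t, ht, hpend⟩ := hq
  have hb := (h.of_eq_some ht).2.2
  have hT := h.tile p.1 t (by rw [← hb]; exact ht)
  obtain ⟨α, hα⟩ := Multiset.exists_mem_of_ne_zero hpend
  obtain ⟨d, g, rfl, hF⟩ := hT.pending_le α hα
  obtain ⟨rest, hrest⟩ := Multiset.exists_cons_of_mem hα
  obtain ⟨q, hq⟩ := Option.isSome_iff_exists.1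
    ((hT.isSome_iff d g).2 (h.spec.horizontal _ _ _ hF))
  have hq' : q.next .on = .on := by
    have := hT.ne_off d g
    rw [hq] at this
    cases q <;> simp_all [GState.next]
  set c' := turnOn A.tile p t d g rest with hc'
  set N : ℤ × ℤ → Side → Finset (Glue k) :=
    fun p' d' => bonds c' p' d' \ bonds A.tile p' d' with hN
  have hp : p ∈ A.dom := (A.mem_dom p).2 (by simp [ht])
  refine ⟨⟨fire c' N, A.dom, fun p' => ?_, A.nonempty⟩, ⟨p, t, d, g, .on, q, rest, ht, hq, hrest, ?_⟩,
    rfl, ?_⟩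
  · rw [A.mem_dom, isSome_fire, hc']
    unfold turnOn
    split
    · rename_i h; simp [h, ht]
    · rfl
  · simp only [hq']
    rfl
  · simp only [latentCount_fire]
    have hne : ∀ p', p' ≠ p → c' p' = A.tile p' := fun p' h => by simp [hc', turnOn, h]
    have hcp : c' p = some { t with
        glue := fun d' g' => if d' = d ∧ g' = g then some .on else t.glue d' g'
        pending := rest } := by simp [hc', turnOn]
    have hle : latentCount (c' p) ≤ latentCount (A.tile p) := by
      rw [hcp, ht]
      refine Finset.card_le_card fun r hr => ?_
      simp only [Finset.mem_filter, Finset.mem_univ, true_and] at hr ⊢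
      split at hr <;> simp_all
    cases q with
    | off => simp [GState.next] at hq'
    | latent =>
      -- Turning on a latent glue may form bonds that add pending actions; the drop in latent glues
      -- outweighs this in the lexicographic order.
      left
      refine Finset.sum_lt_sum (fun p' _ => ?_) ⟨p, hp, ?_⟩
      · by_cases hpp : p' = p
        · rw [hpp]; exact hle
        · rw [hne p' hpp]
      · rw [hcp, ht]
        refine Finset.card_lt_card (Finset.ssubset_iff_of_subset ?_ |>.2 ⟨(d, g), ?_, ?_⟩)
        · intro r hr
          simp only [Finset.mem_filter, Finset.mem_univ, true_and] at hr ⊢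
          split at hr <;> simp_all
        · simp [hq]
        · simp
    | on =>
      right
      -- The glue was on already, so only the pending multiset changes and no new bond fires.
      have hglue : (fun d' g' => if d' = d ∧ g' = g then some .on else t.glue d' g') = t.glue := by
        funext d' g'
        split
        · rename_i h; rw [h.1, h.2, hq]
        · rfl
      rw [hglue] at hcp
      have hon : onGlues c' = onGlues A.tile := by
        funext p' d'
        by_cases hpp : p' = p
        · subst hpp; simp only [onGlues, hcp, ht]
        · simp only [onGlues, hne p' hpp]
      have hN0 : N = fun _ _ => ∅ := by
        funext p' d'
        simp only [hN, bonds, hon, Finset.sdiff_self]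
      have hfire : fire c' N = c' := by
        funext p'
        rw [hN0]
        unfold fire
        cases c' p' <;> simp
      rw [hfire]
      constructor
      · refine Finset.sum_congr rfl fun p' _ => ?_
        by_cases hpp : p' = p
        · subst hpp; rw [hcp, ht]; rfl
        · rw [hne p' hpp]
      · refine Finset.sum_lt_sum (fun p' _ => ?_) ⟨p, hp, ?_⟩
        · by_cases hpp : p' = p
          · subst hpp; rw [hcp, ht]; simp [pendingCount, hrest]
          · rw [hne p' hpp]
        · rw [hcp, ht]; simp [pendingCount, hrest]

/-- Every line can execute its pending actions until none is left. -/
theorem IsLine.exists_quiet {A : Supertile (Glue k) (Bool × Bool)} {i : ℕ} {s x : Bool}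
    (hA : IsLine A i s x) :
    ∃ B, Relation.ReflTransGen GlueTransition A B ∧ IsLine B i s x ∧ Quiet B := by
  have key : ∀ m : ℕ ×ₗ ℕ, ∀ A : Supertile (Glue k) (Bool × Bool), IsLine A i s x →
      toLex (∑ p ∈ A.dom, latentCount (A.tile p), ∑ p ∈ A.dom, pendingCount (A.tile p)) = m →
      ∃ B, Relation.ReflTransGen GlueTransition A B ∧ IsLine B i s x ∧ Quiet B := by
    intro m
    induction m using WellFoundedLT.induction with
    | ind m ih =>
      rintro A hA rfl
      by_cases hq : Quiet A
      · exact ⟨A, .refl, hA, hq⟩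
      · obtain ⟨B, hAB, -, hlt⟩ := hA.exists_lt hq
        obtain ⟨C, hBC, hC⟩ := ih _ (Prod.Lex.toLex_lt_toLex.2 hlt) B (hA.glueTransition hAB) rfl
        exact ⟨C, .head hAB hBC, hC⟩
  exact key _ A hA rfl

/-- All eventual glues of a quiet line are on. -/
theorem LineState.on_of_quiet {A : Supertile (Glue k) (Bool × Bool)}
    {F : ℤ → Side → Glue k → Prop} {i : ℕ} {s x : Bool} {a e b : ℤ}
    (h : LineState A.tile (fun _ _ => ∅) F i s x a e b) (hq : Quiet A) :
    ∀ n, a ≤ n → n ≤ e → ∀ d g, F n d g → g ∈ onGlues A.tile (n, b) d := by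
  -- Minimality of `F` is applied to the glues now on: with nothing pending, every fired request is
  -- on, so this set is closed.
  refine h.complete (fun n d g => g ∈ onGlues A.tile (n, b) d) (fun _ _ _ hg => hg) ?_
  intro n h1 h2 g he hw d' g'
  have hbe : g ∈ bonds A.tile (n, b) .east := by
    rw [mem_bonds]; exact ⟨he, by simpa [Side.vec, Side.opp] using hw⟩
  have hbw : g ∈ bonds A.tile (n + 1, b) .west := by
    rw [← mem_bonds_opp] at hbe; simpa [Side.vec, Side.opp] using hbe
  have aux : ∀ n d, g ∈ bonds A.tile (n, b) d → Req d g d' g' → g' ∈ onGlues A.tile (n, b) d' := by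
    intro n d hg hr
    obtain ⟨t, ht, -⟩ := mem_onGlues.1 (mem_bonds.1 hg).1
    have := (h.fired n d g t ht hg).resolve_left (by simp) d' g' hr
    rw [hq _ _ ht] at this
    exact mem_onGlues.2 ⟨t, ht, this.resolve_right (by simp)⟩
  exact ⟨aux _ _ hbe, aux _ _ hbw⟩

/-! ### Doubling of quiet lines -/

/-- Two quiet lines of level `i < k` and of opposite kinds combine, in either role. -/
theorem IsLine.exists_combine {A B : Supertile (Glue k) (Bool × Bool)} {i : ℕ} {s x y : Bool}
    {strength : Glue k → ℤ} (hs : ∀ g, strength g = 1) (hi : i < k) (hA : IsLine A i s x)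
    (hB : IsLine B i (!s) y) (hqA : Quiet A) (hqB : Quiet B) :
    ∃ C, Combines strength 1 A B C := by
  have hsA := hA.stable hs
  have hsB := hB.stable hs
  obtain ⟨F₁, a₁, e₁, b₁, h₁⟩ := hA
  obtain ⟨F₂, a₂, e₂, b₂, h₂⟩ := hB
  have key : ∀ v : ℤ × ℤ, Disjoint A.dom (B.dom.image fun p => p + v) →
      (∃ p ∈ A.dom, ∃ d : Side, p + d.vec ∈ B.dom.image (fun p => p + v) ∧
        (bonds (union A.tile (shift v B.tile)) p d).Nonempty) → ∃ C, Combines strength 1 A B C := by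
    intro v hdis hcut
    refine ⟨⟨fire (union A.tile (shift v B.tile))
      (fun p d => bonds (union A.tile (shift v B.tile)) p d \
        (bonds A.tile p d ∪ bonds (shift v B.tile) p d)),
      A.dom ∪ B.dom.image (fun p => p + v), fun p => ?_, A.nonempty.mono Finset.subset_union_left⟩,
      hsA, hsB, v, hdis, ?_, rfl⟩
    · rw [isSome_fire]
      have : p ∈ B.dom.image (fun p => p + v) ↔ (shift v B.tile p).isSome = true := by
        simp only [Finset.mem_image, shift, ← B.mem_dom]
        constructor
        · rintro ⟨q, hq, rfl⟩; simpa using hq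
        · exact fun hp => ⟨_, hp, by simp⟩
      rw [Finset.mem_union, this, A.mem_dom]
      simp [union]
    · rw [Nat.cast_one, one_le_cutStrength_iff hs]; exact hcut
  have hdA : ∀ p, p ∈ A.dom ↔ a₁ ≤ p.1 ∧ p.1 ≤ e₁ ∧ p.2 = b₁ := fun p =>
    (A.mem_dom p).trans (h₁.dom p)
  have hdB : ∀ v p, p ∈ B.dom.image (fun p => p + v) ↔
      a₂ + v.1 ≤ p.1 ∧ p.1 ≤ e₂ + v.1 ∧ p.2 = b₂ + v.2 := by
    intro v p
    refine Iff.trans ?_ ((h₂.shift v).dom p)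
    simp only [Finset.mem_image, shift, ← B.mem_dom]
    constructor
    · rintro ⟨q, hq, rfl⟩; simpa using hq
    · exact fun hp => ⟨_, hp, by simp⟩
  have hl₁ := h₁.le
  have hl₂ := h₂.le
  have bond : ∀ v : ℤ × ℤ, Disjoint A.dom (B.dom.image fun p => p + v) → ∀ p q d g,
      g ∈ onGlues A.tile p d → g ∈ onGlues B.tile q d.opp → p + d.vec = q + v →
      ∃ p ∈ A.dom, ∃ d : Side, p + d.vec ∈ B.dom.image (fun p => p + v) ∧
        (bonds (union A.tile (shift v B.tile)) p d).Nonempty := by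
    intro v hdis p q d g hp hq hpq
    obtain ⟨t, ht, -⟩ := mem_onGlues.1 hp
    obtain ⟨u, hu, -⟩ := mem_onGlues.1 hq
    have hpA : p ∈ A.dom := (A.mem_dom p).2 (by simp [ht])
    have hqB : p + d.vec ∈ B.dom.image (fun p => p + v) := by
      rw [hpq]; exact Finset.mem_image_of_mem _ ((B.mem_dom q).2 (by simp [hu]))
    have hd : ∀ p, A.tile p = none ∨ shift v B.tile p = none := by
      intro p
      by_contra! hp
      refine Finset.disjoint_left.1 hdis
        ((A.mem_dom p).2 (Option.isSome_iff_ne_none.2 hp.1)) ?_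
      exact Finset.mem_image.2
        ⟨p - v, (B.mem_dom _).2 (Option.isSome_iff_ne_none.2 hp.2), by simp⟩
    refine ⟨p, hpA, d, hqB, g, ?_⟩
    rw [mem_bonds, mem_onGlues_union hd, mem_onGlues_union hd]
    refine ⟨.inl hp, .inr ?_⟩
    have : onGlues (shift v B.tile) (p + d.vec) d.opp = onGlues B.tile q d.opp := by
      rw [hpq]; simp [onGlues, shift]
    rw [this]; exact hq
  cases s with
  | true =>
    -- The one `bond` glue common to both faces; the translation below puts the west end of `B` next
    -- to the east end of `A`.
    let g : Glue k := (⟨i, hi⟩, .bond x y)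
    have hg₁ := h₁.on_of_quiet hqA e₁ hl₁ le_rfl .east g
      ((h₁.spec.east_end g).2 ⟨rfl, rfl, .inr ⟨y, rfl⟩⟩)
    have hg₂ := h₂.on_of_quiet hqB a₂ le_rfl hl₂ .west g
      ((h₂.spec.west_end g).2 ⟨rfl, rfl, .inr ⟨x, rfl⟩⟩)
    have hdis : Disjoint A.dom (B.dom.image fun p => p + (e₁ + 1 - a₂, b₁ - b₂)) := by
      rw [Finset.disjoint_left]
      intro p hp hp'
      rw [hdA] at hp
      rw [hdB] at hp'
      simp only at hp'
      omega
    exact key _ hdis (bond _ hdis _ _ .east g hg₁ hg₂ (by ext <;> simp [Side.vec]))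
  | false =>
    let g : Glue k := (⟨i, hi⟩, .bond y x)
    have hg₁ := h₁.on_of_quiet hqA a₁ le_rfl hl₁ .west g
      ((h₁.spec.west_end g).2 ⟨rfl, rfl, .inr ⟨y, rfl⟩⟩)
    have hg₂ := h₂.on_of_quiet hqB e₂ hl₂ le_rfl .east g
      ((h₂.spec.east_end g).2 ⟨rfl, rfl, .inr ⟨x, rfl⟩⟩)
    have hdis : Disjoint A.dom (B.dom.image fun p => p + (a₁ - 1 - e₂, b₁ - b₂)) := by
      rw [Finset.disjoint_left]
      intro p hp hp'
      rw [hdA] at hp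
      rw [hdB] at hp'
      simp only at hp'
      omega
    exact key _ hdis (bond _ hdis _ _ .west g hg₁ hg₂ (by ext <;> simp [Side.vec]; ring))

theorem producible_of_glueTransitions {A B : Supertile (Glue k) (Bool × Bool)}
    (hA : (system k).Producible A) (h : Relation.ReflTransGen GlueTransition A B) :
    (system k).Producible B := by
  induction h with
  | refl => exact hA
  | tail _ h ih => exact .glue ih h

/-- Quiet lines of every level and kind are producible. -/
theorem exists_quiet_line {i : ℕ} (hi : i ≤ k) (s x : Bool) :
    ∃ A, (system k).Producible A ∧ IsLine A i s x ∧ Quiet A := by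
  induction i generalizing s x with
  | zero =>
    refine ⟨Supertile.single (tile k (s, x)), .base ⟨(s, x), rfl⟩, IsLine.single (s, x),
      fun p t ht => (system k).initial_pending _ ⟨(s, x), rfl⟩ p t ht⟩
  | succ i ih =>
    -- The role `s` of the product is the payload of its left part, and `x` is the payload of its
    -- right part.
    obtain ⟨A, hpA, hA, hqA⟩ := ih (by omega) true s
    obtain ⟨B, hpB, hB, hqB⟩ := ih (by omega) false x
    obtain ⟨C, hC⟩ := hA.exists_combine (strength := fun _ => 1) (fun _ => rfl) hi hB hqA hqB
    have hC' : IsLine C (i + 1) s x := by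
      rcases hA.combine (fun _ => rfl) hB hC with ⟨-, -, h⟩ | ⟨h, -⟩
      · exact h
      · exact absurd h (by simp)
    obtain ⟨D, hCD, hD, hqD⟩ := hC'.exists_quiet
    exact ⟨D, producible_of_glueTransitions (.combine hpA hpB hC) hCD, hD, hqD⟩

theorem IsLine.level_le {A : Supertile (Glue k) (Bool × Bool)} {i : ℕ} {s x : Bool}
    (h : IsLine A i s x) : i ≤ k := by
  obtain ⟨F, a, e, b, h⟩ := h
  exact h.level_le

theorem IsLine.exists_next {A : Supertile (Glue k) (Bool × Bool)} {i : ℕ} {s x : Bool}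
    (h : IsLine A i s x) (hi : i < k) (hq : Quiet A) :
    ∃ B, (∃ C, (system k).Producible C ∧ Combines (system k).strength (system k).temperature A C B)
      ∧ ∃ r y, IsLine B (i + 1) r y := by
  -- Any payload of the partner would do, since a face offers a `bond` glue for each opposite bit.
  obtain ⟨C, hpC, hC, hqC⟩ := exists_quiet_line hi.le (!s) x
  obtain ⟨B, hB⟩ := h.exists_combine (strength := fun _ => 1) (fun _ => rfl) hi hC hq hqC
  refine ⟨B, ⟨C, hpC, hB⟩, ?_⟩
  rcases h.combine (fun _ => rfl) hC hB with ⟨-, -, h⟩ | ⟨-, -, h⟩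
  · exact ⟨_, _, h⟩
  · exact ⟨_, _, h⟩

/-! ### Terminal supertiles -/

/-- Quiet lines of level `k` are terminal. -/
theorem terminal_of_quiet {A : Supertile (Glue k) (Bool × Bool)} {s x : Bool}
    (hp : (system k).Producible A) (h : IsLine A k s x) (hq : Quiet A) :
    (system k).Terminal A := by
  refine ⟨hp, fun B hB => ?_⟩
  rcases hB with ⟨C, hpC, hC⟩ | ⟨C, hC⟩ | hB | hB
  · obtain ⟨j, r, y, hl⟩ := isLine_of_producible hpC
    -- A combination would be a line of level `k + 1`.
    rcases h.combine (fun _ => rfl) hl hC with ⟨-, -, h⟩ | ⟨-, -, h⟩ <;>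
    · have := h.level_le; omega
  · exact h.not_breaks (fun _ => rfl) hC
  · obtain ⟨F, a, e, b, h⟩ := h
    obtain ⟨p, t, d, g, rest, ht, hpend, -⟩ := h.eq_turnOn hB
    rw [hq _ _ ht] at hpend
    exact absurd hpend.symm (Multiset.cons_ne_zero)
  · exact h.not_labelTransition hB

theorem exists_terminal_of_producible {A : Supertile (Glue k) (Bool × Bool)}
    (hA : (system k).Producible A) :
    ∃ B, Relation.ReflTransGen (system k).Step A B ∧ (system k).Terminal B := by
  obtain ⟨i, s, x, h⟩ := isLine_of_producible hA
  obtain ⟨m, hm⟩ := Nat.exists_eq_add_of_le h.level_le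
  -- Induction on the number `m = k - i` of doublings still missing.
  induction m generalizing A i s x with
  | zero =>
    obtain rfl : k = i := hm
    obtain ⟨B, hAB, hB, hq⟩ := h.exists_quiet
    exact ⟨B, hAB.lift id fun _ _ h => .inr (.inr (.inl h)),
      terminal_of_quiet (producible_of_glueTransitions hA hAB) hB hq⟩
  | succ m ih =>
    obtain ⟨B, hAB, hB, hq⟩ := h.exists_quiet
    obtain ⟨D, ⟨C, hpC, hC⟩, r, y, hD⟩ := hB.exists_next (by omega) hq
    have hpB := producible_of_glueTransitions hA hAB
    obtain ⟨E, hDE, hE⟩ := ih (.combine hpB hpC hC) _ _ _ hD (by omega)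
    exact ⟨E, (hAB.lift id fun _ _ h => .inr (.inr (.inl h))).trans
      (.head (.inl ⟨C, hpC, hC⟩) hDE), hE⟩

theorem dom_of_terminal {A : Supertile (Glue k) (Bool × Bool)} (hA : (system k).Terminal A) :
    ∃ v : ℤ × ℤ, (A.dom : Set (ℤ × ℤ)) = (fun p => p + v) '' line (2 ^ k) := by
  obtain ⟨i, s, x, h⟩ := isLine_of_producible hA.1
  have hq : Quiet A := by
    by_contra hq
    obtain ⟨B, hAB, -⟩ := h.exists_lt hq
    exact hA.2 B (.inr (.inr (.inl hAB)))
  obtain rfl : i = k := by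
    by_contra hne
    obtain ⟨B, hB, -⟩ := h.exists_next (lt_of_le_of_ne h.level_le hne) hq
    exact hA.2 B (.inl hB)
  obtain ⟨F, a, e, b, h⟩ := h
  refine ⟨(a, b), ?_⟩
  have hl := h.length
  ext p
  rw [Finset.mem_coe, A.mem_dom, h.dom]
  simp only [line, Set.mem_image, Set.mem_ofPred_eq, Nat.cast_pow, Nat.cast_ofNat]
  constructor
  · intro hp
    exact ⟨p - (a, b), ⟨by simp; omega, by simp; omega, by simp; omega⟩, by simp⟩
  · rintro ⟨q, hq, rfl⟩
    simp only [Prod.fst_add, Prod.snd_add]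
    omega

theorem uniquelyAssembles (k : ℕ) : (system k).UniquelyAssembles (line (2 ^ k)) :=
  ⟨(exists_terminal_of_producible (.base ⟨(true, true), rfl⟩)).imp fun _ h => h.2,
    fun _ h => dom_of_terminal h, fun _ h => exists_terminal_of_producible h⟩

/-- The labels serve only this purpose: for `k = 0` there are no glues to tell the four types apart.
-/
theorem tile_injective (k : ℕ) : Function.Injective (tile k) := by
  intro κ κ' h
  have := congrFun (congrArg ActiveTile.label h) κ
  simp only [tile] at this
  by_contra hne
  simp [hne] at this

end Doubling

theorem Supertile.single_injective {Γ Λ : Type} :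
    Function.Injective (Supertile.single : ActiveTile Γ Λ → Supertile Γ Λ) := by
  intro t u h
  have := congrFun (congrArg Supertile.tile h) (0, 0)
  simpa [Supertile.single] using this

namespace Doubling

theorem glueCount_tile_le (k : ℕ) (κ : Bool × Bool) : (tile k κ).glueCount ≤ 16 * k := by
  -- Each level has four `bond`, two `east` and two `west` symbols; two sides carry glues, whence
  -- the constant 16.
  have hcard : Fintype.card (Glue k) = 8 * k := by
    rw [Fintype.card_prod, Fintype.card_fin, mul_comm]; rfl
  have hle : ∀ d, (Finset.univ.filter fun g : Glue k =>
      ((tile k κ).glue d g).isSome = true).card ≤ if d = .east ∨ d = .west then 8 * k else 0 := by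
    intro d
    split
    · exact (Finset.card_le_univ _).trans hcard.le
    · simp [tile, *]
  refine (Finset.sum_le_sum fun d _ => hle d).trans ?_
  have : (Finset.univ : Finset Side) = {.north, .south, .east, .west} := rfl
  rw [this]
  simp
  omega

end Doubling
end STAM

theorem theorem2 :
    ∃ C : ℕ, ∀ k : ℕ,
      ∃ (Γ Λ : Type) (_ : Fintype Γ) (_ : DecidableEq Γ) (S : STAM.System Γ Λ),
        S.temperature = 1 ∧
        (∀ g, S.strength g = 1) ∧
        (∀ A ∈ S.initial, ∃ t, A = STAM.Supertile.single t) ∧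
        S.initial.ncard = 4 ∧
        (∀ t, STAM.Supertile.single t ∈ S.initial → t.glueCount ≤ C * k) ∧
        S.UniquelyAssembles (STAM.line (2 ^ k)) := by
  refine ⟨16, fun k => ⟨STAM.Doubling.Glue k, Bool × Bool, inferInstance, inferInstance,
    STAM.Doubling.system k, rfl, fun _ => rfl, ?_, ?_, ?_, STAM.Doubling.uniquelyAssembles k⟩⟩
  · rintro _ ⟨κ, rfl⟩
    exact ⟨_, rfl⟩
  · change (Set.range (STAM.Supertile.single ∘ STAM.Doubling.tile k)).ncard = 4
    rw [← Nat.card_coe_set_eq, Nat.card_range_of_injective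
      (STAM.Supertile.single_injective.comp (STAM.Doubling.tile_injective k))]
    simp
  · rintro t ⟨κ, h⟩
    rw [← STAM.Supertile.single_injective h]
    exact STAM.Doubling.glueCount_tile_le k κ
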